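/- Let $\mathfrak{g}$ be the $\mathbb{Z}$-Lie algebra that is free as a $\mathbb{Z}$-module on $v_1,\dots,v_6$, with brackets $$[v_1,v_2]=[v_3,v_4]=v_5,\qquad [v_1,v_4]=[v_2,v_3]=v_6,$$ and $[v_i,v_j]=0$ for all other pairs $i<j$; it is nilpotent of class $2$. Let $p$ be an odd prime, $f\ge 1$ an integer, $q:=p^f$, and let $\mathbb{F}_q$ be the finite field with $q$ elements. Let $\mathscr{G}_q:=\exp(\mathfrak{g}\otimes_{\mathbb{Z}}\mathbb{F}_q)$ be the finite $p$-group whose underlying set is $\mathfrak{g}\otimes_{\mathbb{Z}}\mathbb{F}_q$ and whose multiplication is given by the Campbell-Baker-Hausdorff formula, which here reads $x*y=x+y+\tfrac12[x,y]$. Let $m_{\mathrm{faithful}}(\mathscr{G}_q)$ denote the smallest dimension of a faithful complex representation of $\mathscr{G}_q$. Then $$m_{\mathrm{faithful}}(\mathscr{G}_q)=\begin{cases}2fq & \text{if } p\equiv 1\pmod 4;\\ 2fq & \text{if } p\equiv 3\pmod 4 \text{ and } f \text{ is even};\\ 2fq^2 & \text{if } p\equiv 3\pmod 4 \text{ and }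 f \text{ is odd}.\end{cases}$$ -/

import Mathlib

open scoped TensorProduct

/-- The faithful dimension of a group `G` over a field `K`: the smallest `n` such that `G` has a
faithful `K`-representation of dimension `n`. -/
noncomputable def faithfulDim (K G : Type*) [Field K] [Group G] : ℕ :=
  sInf {n : ℕ | ∃ ρ : Representation K G (Fin n → K), Function.Injective ρ}

/-- A Lie ring is nilpotent of class at most two if all iterated brackets of length three
vanish. -/
class NilpotentClassLETwo (L : Type*) [LieRing L] : Prop where
  lie_lie_eq_zero : ∀ x y z : L, ⁅x, ⁅y, z⁆⁆ = 0

/-- The underlying set of the group `exp(L)`, for a Lie algebra `L` over a field `K`;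
it is a copy of `L`. -/
@[ext]
structure LieExp (K L : Type*) where
  ofLie ::
  toLie : L

namespace LieExp

instance {K L : Type*} [LieRing L] : One (LieExp K L) := ⟨⟨0⟩⟩

instance {K L : Type*} [LieRing L] : Inv (LieExp K L) := ⟨fun x => ⟨-x.toLie⟩⟩

theorem toLie_one (K L : Type*) [LieRing L] : (1 : LieExp K L).toLie = 0 := rfl

theorem toLie_inv {K L : Type*} [LieRing L] (x : LieExp K L) : (x⁻¹).toLie = -x.toLie := rfl

variable {K L : Type*} [Field K] [LieRing L] [LieAlgebra K L]

/-- The Campbell-Baker-Hausdorff product for nilpotency class at most two,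
`x * y = x + y + (1/2) [x, y]`. -/
noncomputable instance : Mul (LieExp K L) :=
  ⟨fun x y => ⟨x.toLie + y.toLie + (2 : K)⁻¹ • ⁅x.toLie, y.toLie⁆⟩⟩

theorem toLie_mul (x y : LieExp K L) :
    (x * y).toLie = x.toLie + y.toLie + (2 : K)⁻¹ • ⁅x.toLie, y.toLie⁆ := rfl

/-- The group `exp(L)` of a Lie algebra `L` of nilpotency class at most two. -/
noncomputable instance [NilpotentClassLETwo L] : Group (LieExp K L) :=
  Group.ofLeftAxioms
    (fun x y z => by
      have h1 := NilpotentClassLETwo.lie_lie_eq_zero x.toLie y.toLie z.toLie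
      have h2 : ⁅⁅x.toLie, y.toLie⁆, z.toLie⁆ = 0 := by
        rw [← lie_skew, NilpotentClassLETwo.lie_lie_eq_zero, neg_zero]
      ext
      simp only [toLie_mul, add_lie, lie_add, smul_lie, lie_smul, h1, h2, smul_zero, add_zero,
        smul_add]
      abel)
    (fun x => by ext; simp [toLie_mul, toLie_one])
    (fun x => by ext; simp [toLie_mul, toLie_one, toLie_inv])

end LieExp

/-- Extension of scalars preserves nilpotency of class at most two. -/
instance (R A L : Type*) [CommRing R] [CommRing A] [Algebra R A] [LieRing L] [LieAlgebra R L]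
    [NilpotentClassLETwo L] : NilpotentClassLETwo (A ⊗[R] L) where
  lie_lie_eq_zero x y z := by
    induction x using TensorProduct.induction_on with
    | zero => simp
    | add a b ha hb => rw [add_lie, ha, hb, add_zero]
    | tmul a u =>
      induction y using TensorProduct.induction_on with
      | zero => simp
      | add c d hc hd => rw [add_lie, lie_add, hc, hd, add_zero]
      | tmul b v =>
        induction z using TensorProduct.induction_on with
        | zero => simp
        | add c d hc hd => rw [lie_add, lie_add, hc, hd, add_zero]
        | tmul c w =>
          simp [LieAlgebra.ExtendScalars.bracket_tmul,
            NilpotentClassLETwo.lie_lie_eq_zero]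

/-- The `ℤ`-Lie algebra that is free as a `ℤ`-module on `v₁, …, v₆`, with
`[v₁, v₂] = [v₃, v₄] = v₅`, `[v₁, v₄] = [v₂, v₃] = v₆` and `[vᵢ, vⱼ] = 0` for all other `i < j`.
An element is given by its coordinates; the index `i : Fin 6` stands for `i + 1`. -/
def BinQuadLie : Type := Fin 6 → ℤ

namespace BinQuadLie

instance : AddCommGroup BinQuadLie := inferInstanceAs (AddCommGroup (Fin 6 → ℤ))

/-- The bracket, written out in coordinates. -/
instance : Bracket BinQuadLie BinQuadLie where
  bracket x y := fun k =>
    (![0, 0, 0, 0,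
      (x 0 * y 1 - x 1 * y 0) + (x 2 * y 3 - x 3 * y 2),
      (x 0 * y 3 - x 3 * y 0) + (x 1 * y 2 - x 2 * y 1)] : Fin 6 → ℤ) k

theorem lie_apply (x y : BinQuadLie) (k : Fin 6) :
    ⁅x, y⁆ k = (![0, 0, 0, 0,
      (x 0 * y 1 - x 1 * y 0) + (x 2 * y 3 - x 3 * y 2),
      (x 0 * y 3 - x 3 * y 0) + (x 1 * y 2 - x 2 * y 1)] : Fin 6 → ℤ) k := rfl

theorem add_apply (x y : BinQuadLie) (i : Fin 6) : (x + y) i = x i + y i := rfl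

theorem zero_apply (i : Fin 6) : (0 : BinQuadLie) i = 0 := rfl

theorem lie_lie_eq_zero (x y z : BinQuadLie) : ⁅x, ⁅y, z⁆⁆ = 0 := by
  funext i
  fin_cases i <;> simp [lie_apply, zero_apply]

instance : LieRing BinQuadLie where
  add_lie x y z := by
    funext i
    fin_cases i <;> simp [lie_apply, add_apply] <;> ring
  lie_add x y z := by
    funext i
    fin_cases i <;> simp [lie_apply, add_apply] <;> ring
  lie_self x := by
    funext i
    fin_cases i <;> simp [lie_apply, zero_apply] <;> ring
  leibniz_lie x y z := by
    have h : ⁅⁅x, y⁆, z⁆ = 0 := by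
      funext i
      fin_cases i <;> simp [lie_apply, zero_apply]
    rw [h, lie_lie_eq_zero, lie_lie_eq_zero, add_zero]

instance : NilpotentClassLETwo BinQuadLie := ⟨lie_lie_eq_zero⟩

/-- The basis vectors: `v 0, …, v 5` are `v₁, …, v₆`. -/
def v (i : Fin 6) : BinQuadLie := Pi.single i 1

/-- The defining relations hold. -/
theorem lie_v (i j : Fin 6) (hij : i < j) :
    ⁅v i, v j⁆ =
      if (i, j) = (0, 1) ∨ (i, j) = (2, 3) then v 4
      else if (i, j) = (0, 3) ∨ (i, j) = (1, 2) then v 5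
      else 0 := by
  have h : ∀ i j : Fin 6, i < j → ∀ k : Fin 6, (⁅v i, v j⁆ k : ℤ) =
      (if (i, j) = (0, 1) ∨ (i, j) = (2, 3) then v 4 k
      else if (i, j) = (0, 3) ∨ (i, j) = (1, 2) then v 5 k
      else 0 : ℤ) := by
    have hv : ∀ i k : Fin 6, v i k = if k = i then (1 : ℤ) else 0 := fun i k => by
      simp [v, Pi.single_apply]
    simp only [lie_apply, hv]
    decide
  funext k
  refine (h i j hij k).trans ?_
  split_ifs <;> rfl

end BinQuadLie

/-! Up to conjugation, the commutator `pairing` of the `(v₁, v₃)`- and `(v₂, v₄)`-coordinates is a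
product: `pairing x y` is x̄y in F[i]/(i² + 1). The answer depends on whether this ring is a field.

Lower bound: restrict a faithful ρ to the abelian subgroup `polarization`. The central parts of its
weights separate the points of the centre F², which has order p^(2f) and exponent p, so at least 2f
of them are nontrivial. Conjugation by `complementElt y` multiplies a weight with central part θ by
x ↦ θ(`pairing x y`). Hence each nontrivial θ carries at least q weights, and q² if F[i] is a field
(`le_of_injective_of_separating`).

Upper bound: sum 2f monomial representations induced from characters. A general central functional
gives dimension q². If i lies in F, the functionals v₅* ± i v₆* make the commutator form degenerate
to rank 2, and dimension q suffices. -/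

/-! ### Weights of a finite abelian group -/

section Weights

variable {A V : Type*} [AddCommGroup A] [AddCommGroup V] [Module ℂ V]

/-- The characters of an abelian group `A` that occur in a complex representation of `A`. -/
def weightSet (σ : Representation ℂ (Multiplicative A) V) : Set (AddChar A ℂ) :=
  {χ | ∃ v : V, v ≠ 0 ∧ ∀ a, σ (.ofAdd a) v = χ a • v}

/-- Unnormalized projection onto the `χ`-weight space. -/
noncomputable def weightProj [Fintype A] (σ : Representation ℂ (Multiplicative A) V)
    (χ : AddChar A ℂ) : V →ₗ[ℂ] V :=
  ∑ a, χ (-a) • σ (.ofAdd a)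

theorem weightProj_apply [Fintype A] (σ : Representation ℂ (Multiplicative A) V)
    (χ : AddChar A ℂ) (v : V) : weightProj σ χ v = ∑ a, χ (-a) • σ (.ofAdd a) v := by
  simp [weightProj, LinearMap.sum_apply]

theorem weightProj_of_weight [Fintype A] (σ : Representation ℂ (Multiplicative A) V)
    (χ θ : AddChar A ℂ) (v : V) (hv : ∀ a, σ (.ofAdd a) v = θ a • v) [Decidable (θ = χ)] :
    weightProj σ χ v = (if θ = χ then (Fintype.card A : ℂ) else 0) • v := by
  classical
  have h := AddChar.sum_eq_ite (θ - χ)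
  simp only [sub_eq_zero, AddChar.sub_apply] at h
  rw [weightProj_apply, show (if θ = χ then (Fintype.card A : ℂ) else 0) =
    ∑ a, θ a * χ (-a) by rw [h], Finset.sum_smul]
  refine Finset.sum_congr rfl fun a _ => ?_
  rw [hv, smul_smul, mul_comm]

theorem apply_weightProj [Fintype A] (σ : Representation ℂ (Multiplicative A) V)
    (χ : AddChar A ℂ) (v : V) (b : A) :
    σ (.ofAdd b) (weightProj σ χ v) = χ b • weightProj σ χ v := by
  rw [weightProj_apply, map_sum, Finset.smul_sum]
  refine Fintype.sum_equiv (Equiv.addLeft b) _ _ fun a => ?_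
  rw [map_smul, ← Module.End.mul_apply, ← map_mul, ← ofAdd_add, smul_smul, Equiv.coe_addLeft,
    ← AddChar.map_add_eq_mul]
  congr 2
  simp

theorem sum_weightProj [Fintype A] (σ : Representation ℂ (Multiplicative A) V) (v : V) :
    ∑ χ, weightProj σ χ v = (Fintype.card A : ℂ) • v := by
  classical
  simp_rw [weightProj_apply]
  rw [Finset.sum_comm]
  simp_rw [← Finset.sum_smul, AddChar.sum_apply_eq_ite, neg_eq_zero]
  simp

theorem apply_eq_one_of_weightSet [Finite A] (σ : Representation ℂ (Multiplicative A) V) (a : A)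
    (h : ∀ χ ∈ weightSet σ, χ a = 1) : σ (.ofAdd a) = 1 := by
  cases nonempty_fintype A
  ext v
  have hA : (Fintype.card A : ℂ) ≠ 0 := Nat.cast_ne_zero.2 Fintype.card_ne_zero
  apply smul_right_injective V hA
  simp only [Module.End.one_apply]
  rw [← map_smul, ← sum_weightProj σ, map_sum]
  refine Finset.sum_congr rfl fun χ _ => ?_
  by_cases h0 : weightProj σ χ v = 0
  · rw [h0, map_zero]
  · rw [apply_weightProj, h χ ⟨_, h0, apply_weightProj σ χ v⟩, one_smul]

/-- Weight vectors for distinct characters are independent: `weightProj` kills all but one of them.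
-/
theorem ncard_weightSet_le [Finite A] [FiniteDimensional ℂ V]
    (σ : Representation ℂ (Multiplicative A) V) :
    (weightSet σ).ncard ≤ Module.finrank ℂ V := by
  classical
  cases nonempty_fintype A
  have hA : (Fintype.card A : ℂ) ≠ 0 := Nat.cast_ne_zero.2 Fintype.card_ne_zero
  choose v hv0 hv using fun χ : weightSet σ => χ.2
  have hli : LinearIndependent ℂ v := by
    rw [Fintype.linearIndependent_iff]
    intro c hc θ
    have h := congrArg (weightProj σ θ.1) hc
    simp_rw [map_sum, map_smul, map_zero, weightProj_of_weight σ θ.1 _ _ (hv _)] at h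
    simpa [Subtype.coe_inj, ite_smul, hA, hv0] using h
  rw [Set.ncard_eq_toFinset_card', Set.toFinset_card]
  exact hli.fintype_card_le_finrank

end Weights

/-! ### Counting characters -/

section Counting

/-- The characters have values in the p-th roots of unity, so together they embed `Z` into a group
of order p^|R|. -/
theorem card_le_of_separating {p k : ℕ} (hp : p.Prime) {Z : Type*} [AddCommGroup Z] [Fintype Z]
    (hZ : Fintype.card Z = p ^ k) (hpZ : ∀ z : Z, p • z = 0)
    {R : Type*} [Fintype R] (c : R → AddChar Z ℂ)
    (hsep : ∀ z, (∀ r, c r z = 1) → z = 0) : k ≤ Fintype.card R := by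
  classical
  have : NeZero p := ⟨hp.ne_zero⟩
  have hu : ∀ r z, c r z ^ p = 1 := fun r z => by
    rw [← AddChar.map_nsmul_eq_pow, hpZ, AddChar.map_zero_eq_one]
  let g : Z → R → rootsOfUnity p ℂ := fun z r => rootsOfUnity.mkOfPowEq (c r z) (hu r z)
  have hg : Function.Injective g := by
    intro z w hzw
    rw [← sub_eq_zero]
    refine hsep _ fun r => ?_
    have h := congrArg (fun x : rootsOfUnity p ℂ => ((x : ℂˣ) : ℂ)) (congrFun hzw r)
    simp only [g, rootsOfUnity.coe_mkOfPowEq] at h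
    rw [AddChar.map_sub_eq_div, h, div_self ((c r).val_isUnit w).ne_zero]
  have := Fintype.ofFinite (rootsOfUnity p ℂ)
  have h := Fintype.card_le_of_injective g hg
  rw [hZ, Fintype.card_fun, ← Nat.card_eq_fintype_card (α := rootsOfUnity p ℂ),
    Complex.card_rootsOfUnity] at h
  exact (Nat.pow_le_pow_iff_right hp.one_lt).1 h

/-- Trivial restrictions to `Z` do not help to separate points, so at least `k` nontrivial ones
occur. The families over different restrictions are disjoint. -/
theorem mul_card_le_ncard {p k : ℕ} (hp : p.Prime) {X Z T : Type*} [AddCommGroup X] [Finite X]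
    [AddCommGroup Z] [Fintype Z] [Fintype T]
    (hZ : Fintype.card Z = p ^ k) (hpZ : ∀ z : Z, p • z = 0)
    (S : Set (AddChar (X × Z) ℂ))
    (hsep : ∀ z : Z, (∀ χ ∈ S, χ (0, z) = 1) → z = 0)
    (horb : ∀ χ ∈ S, (∃ z, χ (0, z) ≠ 1) → ∃ g : T → S, Function.Injective g ∧
      ∀ t z, (g t).1 (0, z) = χ (0, z)) :
    k * Fintype.card T ≤ S.ncard := by
  classical
  let r : AddChar (X × Z) ℂ → AddChar Z ℂ := fun χ => χ.compAddMonoidHom (AddMonoidHom.inr X Z)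
  let R : Set (AddChar Z ℂ) := {θ | θ ≠ 0 ∧ ∃ χ ∈ S, r χ = θ}
  have hk : k ≤ Fintype.card R := by
    refine card_le_of_separating hp hZ hpZ (fun θ : R => θ.1) fun z hz => hsep z fun χ hχ => ?_
    by_cases h0 : r χ = 0
    · exact DFunLike.congr_fun h0 z
    · exact hz ⟨r χ, h0, χ, hχ, rfl⟩
  have hg : ∀ θ : R, ∃ g : T → S, Function.Injective g ∧ ∀ t, r (g t).1 = θ := by
    rintro ⟨_, h0, χ, hχ, rfl⟩
    obtain ⟨g, hg, hgz⟩ := horb χ hχ (AddChar.ne_zero_iff.1 h0)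
    exact ⟨g, hg, fun t => AddChar.ext _ _ fun z => hgz t z⟩
  choose g hg hgr using hg
  have hinj : Function.Injective fun x : R × T => g x.1 x.2 := by
    rintro ⟨θ, t⟩ ⟨θ', t'⟩ h
    have hθ : θ = θ' := Subtype.ext (by
      rw [← hgr θ t, ← hgr θ' t']
      exact congrArg (fun s : S => r s.1) h)
    subst hθ
    exact Prod.ext rfl (hg θ h)
  calc k * Fintype.card T ≤ Fintype.card R * Fintype.card T := Nat.mul_le_mul_right _ hk
    _ = Fintype.card (R × T) := (Fintype.card_prod _ _).symm
    _ ≤ Fintype.card S := Fintype.card_le_of_injective _ hinj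
    _ = S.ncard := by rw [Set.ncard_eq_toFinset_card', Set.toFinset_card]

end Counting

/-! ### Monomial representations -/

section Monomial

/-- The monomial representation attached to a right action of `G` on `J` and a cocycle with
values in `R`, twisted by an additive character of `R`. -/
noncomputable def monomialRep {G J R : Type*} [Group G] [AddCommGroup R] (ψ : AddChar R ℂ)
    (act : G → J → J) (φ : G → J → R) (act_one : ∀ j, act 1 j = j)
    (act_mul : ∀ g h j, act (g * h) j = act h (act g j)) (φ_one : ∀ j, φ 1 j = 0)
    (φ_mul : ∀ g h j, φ (g * h) j = φ g j + φ h (act g j)) : Representation ℂ G (J → ℂ) where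
  toFun g :=
    { toFun := fun w j => ψ (φ g j) * w (act g j)
      map_add' := fun w w' => by ext j; simp [mul_add]
      map_smul' := fun c w => by ext j; simp [mul_left_comm] }
  map_one' := by ext; simp [act_one, φ_one]
  map_mul' g h := by
    refine LinearMap.ext fun w => funext fun j => ?_
    simp [act_mul, φ_mul, AddChar.map_add_eq_mul, mul_assoc]

theorem exists_injective_of_monomial {G J R : Type*} [Group G] [AddCommGroup R] [Fintype J]
    (ψ : AddChar R ℂ)
    (act : G → J → J) (φ : G → J → R) (act_one : ∀ j, act 1 j = j)
    (act_mul : ∀ g h j, act (g * h) j = act h (act g j)) (φ_one : ∀ j, φ 1 j = 0)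
    (φ_mul : ∀ g h j, φ (g * h) j = φ g j + φ h (act g j))
    (hker : ∀ g, (∀ j, act g j = j ∧ ψ (φ g j) = 1) → g = 1) :
    ∃ ρ : Representation ℂ G (Fin (Fintype.card J) → ℂ), Function.Injective ρ := by
  classical
  let ρ := monomialRep ψ act φ act_one act_mul φ_one φ_mul
  have hρ : Function.Injective ρ := by
    rw [injective_iff_map_eq_one]
    intro g hg
    refine hker g fun j => ?_
    -- The image of the delta function at `act g j` has the nonzero value `ψ (φ g j)` at `j`.
    have h := congrFun (LinearMap.congr_fun hg (Pi.single (act g j) 1)) j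
    have h' : ψ (φ g j) = (Pi.single (act g j) (1 : ℂ) : J → ℂ) j := by
      simpa [ρ, monomialRep] using h
    have hj : act g j = j := by
      by_contra hne
      rw [Pi.single_eq_of_ne (Ne.symm hne)] at h'
      exact (ψ.val_isUnit (φ g j)).ne_zero h'
    exact ⟨hj, by rw [h', hj, Pi.single_eq_same]⟩
  let e : (J → ℂ) ≃ₗ[ℂ] (Fin (Fintype.card J) → ℂ) :=
    LinearEquiv.funCongrLeft ℂ ℂ (Fintype.equivFin J).symm
  let E : Module.End ℂ (J → ℂ) ≃* Module.End ℂ (Fin (Fintype.card J) → ℂ) :=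
    (LinearEquiv.conjRingEquiv e).toMulEquiv
  exact ⟨E.toMonoidHom.comp ρ, E.injective.comp hρ⟩

end Monomial

/-! ### Coordinates on the group -/

namespace BinQuadLie

variable {F : Type*} [Field F]

/-- The coordinates of an element of `F ⊗ 𝔤` with respect to `v₁, …, v₆`. -/
noncomputable def coord : (F ⊗[ℤ] BinQuadLie) ≃ₗ[F] (Fin 6 → F) :=
  (TensorProduct.AlgebraTensorModule.congr (R := ℤ) (A := F) (LinearEquiv.refl F F)
    ((AddEquiv.refl (Fin 6 → ℤ) : BinQuadLie ≃+ (Fin 6 → ℤ)).toIntLinearEquiv)).trans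
    (TensorProduct.piScalarRight ℤ F F (Fin 6))

theorem coord_tmul (s : F) (x : BinQuadLie) (k : Fin 6) : coord (s ⊗ₜ[ℤ] x) k = (x k : F) * s := by
  have h : coord (s ⊗ₜ[ℤ] x) k = x k • s := rfl
  rw [h, zsmul_eq_mul]

/-- The bracket of `F ⊗ 𝔤` in coordinates. -/
def coordLie (a b : Fin 6 → F) : Fin 6 → F :=
  ![0, 0, 0, 0,
    (a 0 * b 1 - a 1 * b 0) + (a 2 * b 3 - a 3 * b 2),
    (a 0 * b 3 - a 3 * b 0) + (a 1 * b 2 - a 2 * b 1)]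

theorem coord_lie (x y : F ⊗[ℤ] BinQuadLie) : coord ⁅x, y⁆ = coordLie (coord x) (coord y) := by
  induction x using TensorProduct.induction_on with
  | zero => ext k; fin_cases k <;> simp [coordLie]
  | add x₁ x₂ h₁ h₂ =>
    rw [add_lie, map_add, map_add, h₁, h₂]
    ext k; fin_cases k <;> simp [coordLie] <;> ring
  | tmul s u =>
    induction y using TensorProduct.induction_on with
    | zero =>
      have h := lie_zero (M := F ⊗[ℤ] BinQuadLie) (s ⊗ₜ[ℤ] u)
      rw [h]
      ext k; fin_cases k <;> simp [coordLie]
    | add y₁ y₂ h₁ h₂ =>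
      have h := lie_add (s ⊗ₜ[ℤ] u) y₁ y₂
      rw [h, map_add, map_add, h₁, h₂]
      ext k; fin_cases k <;> simp [coordLie] <;> ring
    | tmul t w =>
      rw [LieAlgebra.ExtendScalars.bracket_tmul]
      ext k
      rw [coord_tmul, lie_apply]
      fin_cases k <;> simp [coordLie, coord_tmul] <;> ring

/-- The coordinates of an element of `exp (F ⊗ 𝔤)`. -/
noncomputable def expCoord : LieExp F (F ⊗[ℤ] BinQuadLie) ≃ (Fin 6 → F) where
  toFun g := coord g.toLie
  invFun a := ⟨coord.symm a⟩
  left_inv g := by simp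
  right_inv a := by simp

theorem expCoord_one : expCoord (1 : LieExp F (F ⊗[ℤ] BinQuadLie)) = 0 := map_zero coord

theorem expCoord_mul (g h : LieExp F (F ⊗[ℤ] BinQuadLie)) :
    expCoord (g * h) = expCoord g + expCoord h +
      (2 : F)⁻¹ • coordLie (expCoord g) (expCoord h) := by
  simp only [expCoord, Equiv.coe_fn_mk, LieExp.toLie_mul, map_add, map_smul, coord_lie]

theorem eq_one_of_expCoord {g : LieExp F (F ⊗[ℤ] BinQuadLie)} (h : expCoord g = 0) : g = 1 :=
  expCoord.injective (h.trans expCoord_one.symm)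

/-! ### Construction of faithful representations -/

section Upper

variable [Fintype F]

/-- A finite field with `p ^ f` elements carries a complex additive character and `f` scalars
that detect zero. -/
theorem exists_addChar_separating {p f : ℕ} (hp : p.Prime) (hF : Fintype.card F = p ^ f) :
    ∃ (ψ : AddChar F ℂ) (c : Fin f → F), ∀ w, (∀ j, ψ (c j * w) = 1) → w = 0 := by
  have : Fact p.Prime := ⟨hp⟩
  have : CharP F p := charP_of_card_eq_prime_pow hF
  let _ : Algebra (ZMod p) F := ZMod.algebra F p
  have hf : Module.finrank (ZMod p) F = f := by
    have h := Module.card_eq_pow_finrank (K := ZMod p) (V := F)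
    rw [hF, ZMod.card] at h
    exact (Nat.pow_right_injective hp.two_le h).symm
  obtain ⟨ψ, hψ⟩ := AddChar.exists_apply_ne_zero.2 (one_ne_zero (α := F))
  let B := (Module.finBasis (ZMod p) F).reindex (finCongr hf)
  refine ⟨ψ, B, fun w hw => ?_⟩
  by_contra hw0
  -- By additivity ψ is trivial on all of F·w = F, although ψ(1) ≠ 1.
  have key : ∀ x : F, ψ (x * w) = 1 := by
    intro x
    have hx : x ∈ Submodule.span (ZMod p) (Set.range B) := by rw [B.span_eq]; trivial
    induction hx using Submodule.span_induction with
    | mem x hx => obtain ⟨j, rfl⟩ := hx; exact hw j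
    | zero => simp
    | add x y _ _ hx hy => rw [add_mul, AddChar.map_add_eq_mul, hx, hy, one_mul]
    | smul r x _ hx =>
      rw [← ZMod.natCast_zmod_val r, Nat.cast_smul_eq_nsmul, smul_mul_assoc,
        AddChar.map_nsmul_eq_pow, hx, one_pow]
  exact hψ (by simpa [hw0] using key w⁻¹)

/-- For ε² = -1 the form v₅* + ε v₆* of the bracket is (v₁* - ε v₃*) ∧ (v₂* + ε v₄*), so a
Heisenberg group acts on functions on `F`. The two roots ε together detect all coordinates. -/
theorem exists_faithful_of_sq_eq_neg_one {p f : ℕ} (hp : p.Prime) (h2 : (2 : F) ≠ 0)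
    (hF : Fintype.card F = p ^ f) (i : F) (hi : i * i = -1) :
    ∃ ρ : Representation ℂ (LieExp F (F ⊗[ℤ] BinQuadLie)) (Fin (2 * f * p ^ f) → ℂ),
      Function.Injective ρ := by
  obtain ⟨ψ, c, hc⟩ := exists_addChar_separating hp hF
  let ε : Fin 2 → F := ![i, -i]
  have hε : ∀ k, ε k * ε k = -1 := fun k => by fin_cases k <;> simp [ε, hi]
  have hcard : Fintype.card ((Fin 2 × Fin f) × F) = 2 * f * p ^ f := by simp [hF]
  have hi0 : i ≠ 0 := by rintro rfl; simp at hi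
  have hpm : ∀ x y : F, (∀ k, x + ε k * y = 0) → x = 0 ∧ y = 0 := by
    intro x y h
    have h0 : x + i * y = 0 := h 0
    have h1 : x + -i * y = 0 := h 1
    have hx : 2 * x = 0 := by linear_combination h0 + h1
    have hy : (2 * i) * y = 0 := by linear_combination h0 - h1
    exact ⟨by simpa [h2] using hx, by simpa [h2, hi0] using hy⟩
  rw [← hcard]
  refine exists_injective_of_monomial ψ
    (fun g j => (j.1, j.2 - (expCoord g 1 + ε j.1.1 * expCoord g 3)))
    (fun g j => c j.1.2 * (expCoord g 4 + ε j.1.1 * expCoord g 5 +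
      (expCoord g 0 - ε j.1.1 * expCoord g 2) *
        (j.2 - 2⁻¹ * (expCoord g 1 + ε j.1.1 * expCoord g 3)))) ?_ ?_ ?_ ?_ ?_
  · rintro ⟨j, t⟩
    simp [expCoord_one]
  · rintro g h ⟨j, t⟩
    simp [expCoord_mul, coordLie]
    ring
  · rintro ⟨j, t⟩
    simp [expCoord_one]
  · rintro g h ⟨⟨k, j⟩, t⟩
    have h2' : (2 : F) * 2⁻¹ = 1 := mul_inv_cancel₀ h2
    simp [expCoord_mul, coordLie]
    linear_combination c j * (-expCoord g 1 * expCoord h 0 + expCoord g 1 * expCoord h 2 * ε k -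
        expCoord h 0 * expCoord g 3 * ε k - expCoord g 3 * expCoord h 2) * h2' +
      c j * (2⁻¹ * expCoord g 2 * expCoord h 3 + 2⁻¹ * expCoord g 3 * expCoord h 2 -
        expCoord g 3 * expCoord h 2) * hε k
  · intro g hg
    -- For f = 0 the hypothesis of `hc` would be vacuous, forcing 1 = 0.
    have hj : Nonempty (Fin f) := by
      rw [← not_isEmpty_iff]
      intro h
      exact one_ne_zero (hc 1 fun j => h.elim j)
    obtain ⟨j₀⟩ := hj
    have hs : ∀ k, expCoord g 1 + ε k * expCoord g 3 = 0 := fun k => by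
      have h : _ - _ = (0 : F) := congrArg Prod.snd (hg ((k, j₀), 0)).1
      linear_combination -h
    have hφ : ∀ k t, expCoord g 4 + ε k * expCoord g 5 +
        (expCoord g 0 - ε k * expCoord g 2) * t = 0 := fun k t => hc _ fun j => by
      simpa [hs] using (hg ((k, j), t)).2
    have h45 := hpm (expCoord g 4) (expCoord g 5) fun k => by simpa using hφ k 0
    have h02 := hpm (expCoord g 0) (-expCoord g 2) fun k => by
      linear_combination hφ k 1 - hφ k 0
    have h13 := hpm _ _ hs
    apply eq_one_of_expCoord
    ext m
    fin_cases m
    exacts [h02.1, h13.1, neg_eq_zero.1 h02.2, h13.2, h45.1, h45.2]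

/-- Here the central functionals are v₅* and v₆*; both forms have rank 4, so functions on `F × F`
are used. -/
theorem exists_faithful {p f : ℕ} (hp : p.Prime) (h2 : (2 : F) ≠ 0)
    (hF : Fintype.card F = p ^ f) :
    ∃ ρ : Representation ℂ (LieExp F (F ⊗[ℤ] BinQuadLie)) (Fin (2 * f * (p ^ f) ^ 2) → ℂ),
      Function.Injective ρ := by
  obtain ⟨ψ, c, hc⟩ := exists_addChar_separating hp hF
  let a : Fin 2 → F := ![1, 0]
  let b : Fin 2 → F := ![0, 1]
  have hcard : Fintype.card ((Fin 2 × Fin f) × (F × F)) = 2 * f * (p ^ f) ^ 2 := by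
    simp [hF, sq]
  rw [← hcard]
  refine exists_injective_of_monomial ψ
    (fun g j => (j.1, (j.2.1 - (a j.1.1 * expCoord g 1 + b j.1.1 * expCoord g 3),
      j.2.2 - (a j.1.1 * expCoord g 3 - b j.1.1 * expCoord g 1))))
    (fun g j => c j.1.2 * (a j.1.1 * expCoord g 4 + b j.1.1 * expCoord g 5 +
      expCoord g 0 * (j.2.1 - 2⁻¹ * (a j.1.1 * expCoord g 1 + b j.1.1 * expCoord g 3)) +
      expCoord g 2 * (j.2.2 - 2⁻¹ * (a j.1.1 * expCoord g 3 - b j.1.1 * expCoord g 1))))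
    ?_ ?_ ?_ ?_ ?_
  · rintro ⟨j, t⟩
    simp [expCoord_one]
  · rintro g h ⟨j, t⟩
    simp [expCoord_mul, coordLie]
    constructor <;> ring
  · rintro ⟨j, t⟩
    simp [expCoord_one]
  · rintro g h ⟨⟨k, j⟩, t⟩
    have h2' : (2 : F) * 2⁻¹ = 1 := mul_inv_cancel₀ h2
    simp [expCoord_mul, coordLie]
    linear_combination c j * (-a k * expCoord g 1 * expCoord h 0 -
        a k * expCoord g 3 * expCoord h 2 + expCoord g 1 * expCoord h 2 * b k -
        expCoord h 0 * expCoord g 3 * b k) * h2'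
  · intro g hg
    have hj : Nonempty (Fin f) := by
      rw [← not_isEmpty_iff]
      intro h
      exact one_ne_zero (hc 1 fun j => h.elim j)
    obtain ⟨j₀⟩ := hj
    have h1 : expCoord g 1 = 0 := by
      simpa [a, b] using congrArg (fun x => x.2.1) (hg ((0, j₀), 0)).1
    have h3 : expCoord g 3 = 0 := by
      simpa [a, b] using congrArg (fun x => x.2.2) (hg ((0, j₀), 0)).1
    have hφ : ∀ k (t : F × F), a k * expCoord g 4 + b k * expCoord g 5 +
        expCoord g 0 * t.1 + expCoord g 2 * t.2 = 0 := fun k t => hc _ fun j => by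
      simpa [h1, h3] using (hg ((k, j), t)).2
    have h4 : expCoord g 4 = 0 := by simpa [a, b] using hφ 0 (0, 0)
    have h5 : expCoord g 5 = 0 := by simpa [a, b] using hφ 1 (0, 0)
    have h0 : expCoord g 0 = 0 := by simpa [a, b, h4] using hφ 0 (1, 0)
    have h2 : expCoord g 2 = 0 := by simpa [a, b, h4] using hφ 0 (0, 1)
    apply eq_one_of_expCoord
    ext m
    fin_cases m
    exacts [h0, h1, h2, h3, h4, h5]

end Upper
-- Conjugation of weights and lower bounds
/-- The abelian subgroup of `exp (F ⊗ 𝔤)` spanned by `v₁, v₃` and the centre. -/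
noncomputable def polarization :
    Multiplicative ((F × F) × (F × F)) →* LieExp F (F ⊗[ℤ] BinQuadLie) where
  toFun a := expCoord.symm ![a.toAdd.1.1, 0, a.toAdd.1.2, 0, a.toAdd.2.1, a.toAdd.2.2]
  map_one' := by
    apply eq_one_of_expCoord
    ext k
    fin_cases k <;> simp
  map_mul' a b := by
    apply expCoord.injective
    rw [expCoord_mul]
    ext k
    fin_cases k <;> simp [coordLie]

/-- The element with `v₂`- and `v₄`-coordinates `y`. -/
noncomputable def complementElt (y : F × F) : LieExp F (F ⊗[ℤ] BinQuadLie) :=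
  expCoord.symm ![0, y.1, 0, y.2, 0, 0]

/-- The commutator pairing between the `(v₁, v₃)`- and the `(v₂, v₄)`-coordinates. -/
def pairing (x y : F × F) : F × F := (x.1 * y.1 + x.2 * y.2, x.1 * y.2 - x.2 * y.1)

theorem polarization_mul_complementElt (h2 : (2 : F) ≠ 0) (x y z : F × F) :
    polarization (.ofAdd (x, z)) * complementElt y =
      complementElt y * polarization (.ofAdd (x, z + pairing x y)) := by
  have h2' : (2 : F) * 2⁻¹ = 1 := mul_inv_cancel₀ h2
  apply expCoord.injective
  rw [expCoord_mul, expCoord_mul]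
  ext k
  fin_cases k <;> simp [coordLie, polarization, complementElt, pairing]
  · linear_combination (x.1 * y.1 + x.2 * y.2) * h2'
  · linear_combination (x.1 * y.2 - x.2 * y.1) * h2'

/-- The character `χ` of the polarization conjugated by the element `y` of the complement. -/
def conjChar (χ : AddChar ((F × F) × (F × F)) ℂ) (y : F × F) :
    AddChar ((F × F) × (F × F)) ℂ where
  toFun a := χ (a.1, a.2 + pairing a.1 y)
  map_zero_eq_one' := by
    rw [← χ.map_zero_eq_one]
    congr 1
    simp [pairing]
  map_add_eq_mul' a b := by
    rw [← AddChar.map_add_eq_mul]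
    congr 1
    ext <;> simp [pairing] <;> ring

theorem conjChar_apply (χ : AddChar ((F × F) × (F × F)) ℂ) (y x z : F × F) :
    conjChar χ y (x, z) = χ (x, z + pairing x y) := rfl

theorem conjChar_mem_weightSet (h2 : (2 : F) ≠ 0) {V : Type*} [AddCommGroup V] [Module ℂ V]
    (ρ : Representation ℂ (LieExp F (F ⊗[ℤ] BinQuadLie)) V)
    {χ : AddChar ((F × F) × (F × F)) ℂ} (hχ : χ ∈ weightSet (ρ.comp polarization)) (y : F × F) :
    conjChar χ y ∈ weightSet (ρ.comp polarization) := by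
  obtain ⟨v, hv0, hv⟩ := hχ
  refine ⟨ρ (complementElt y) v, fun h => hv0 ?_, ?_⟩
  · have h' := congrArg (ρ (complementElt y)⁻¹) h
    rwa [map_zero, ← Module.End.mul_apply, ← map_mul, inv_mul_cancel, map_one,
      Module.End.one_apply] at h'
  · rintro ⟨x, z⟩
    have h := hv (x, z + pairing x y)
    rw [MonoidHom.comp_apply] at h ⊢
    rw [← Module.End.mul_apply, ← map_mul, polarization_mul_complementElt h2, map_mul,
      Module.End.mul_apply, h, map_smul, conjChar_apply]

theorem conjChar_eq_iff (χ : AddChar ((F × F) × (F × F)) ℂ) (y y' : F × F)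
    (h : conjChar χ y = conjChar χ y') (x : F × F) : χ (0, pairing x (y - y')) = 1 := by
  have h' := DFunLike.congr_fun h (x, 0)
  rw [conjChar_apply, conjChar_apply] at h'
  have e : ((0 : F × F), pairing x (y - y')) = (x, 0 + pairing x y) - (x, 0 + pairing x y') := by
    ext <;> simp [pairing] <;> ring
  rw [e, AddChar.map_sub_eq_div, h', div_self (χ.val_isUnit _).ne_zero]

variable [Fintype F]

/-- Lower bound for faithful representations, from a family of conjugating elements that
separates each central character. -/
theorem le_of_injective_of_separating {p f n : ℕ} (hp : p.Prime) (h2 : (2 : F) ≠ 0)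
    (hF : Fintype.card F = p ^ f) {T : Type*} [Fintype T]
    (hT : ∀ θ : AddChar (F × F) ℂ, θ ≠ 0 → ∃ y : T → F × F,
      ∀ t t', (∀ x, θ (pairing x (y t - y t')) = 1) → t = t')
    (ρ : Representation ℂ (LieExp F (F ⊗[ℤ] BinQuadLie)) (Fin n → ℂ))
    (hρ : Function.Injective ρ) : 2 * f * Fintype.card T ≤ n := by
  have : Fact p.Prime := ⟨hp⟩
  have : CharP F p := charP_of_card_eq_prime_pow hF
  have hn := ncard_weightSet_le (ρ.comp (polarization (F := F)))
  rw [Module.finrank_fin_fun] at hn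
  refine le_trans (mul_card_le_ncard hp ?_ ?_ _ ?_ ?_) hn
  · rw [Fintype.card_prod, hF, two_mul, pow_add]
  · intro z
    ext <;> simp [nsmul_eq_mul]
  · intro z hz
    have h := apply_eq_one_of_weightSet _ _ hz
    rw [MonoidHom.comp_apply] at h
    have h' := congrArg expCoord (hρ (h.trans (map_one ρ).symm))
    rw [expCoord_one] at h'
    have h4 := congrFun h' 4
    have h5 := congrFun h' 5
    ext
    · simpa [polarization] using h4
    · simpa [polarization] using h5
  · rintro χ hχ ⟨z, hz⟩
    obtain ⟨y, hy⟩ := hT (χ.compAddMonoidHom (AddMonoidHom.inr _ _)) (AddChar.ne_zero_iff.2 ⟨z, hz⟩)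
    refine ⟨fun t => ⟨conjChar χ (y t), conjChar_mem_weightSet h2 ρ hχ _⟩, fun t t' h => ?_, ?_⟩
    · exact hy t t' (conjChar_eq_iff χ _ _ (congrArg Subtype.val h))
    · intro t z
      rw [conjChar_apply]
      congr 1
      ext <;> simp [pairing]

theorem mul_card_le_of_injective {p f n : ℕ} (hp : p.Prime) (h2 : (2 : F) ≠ 0)
    (hF : Fintype.card F = p ^ f)
    (ρ : Representation ℂ (LieExp F (F ⊗[ℤ] BinQuadLie)) (Fin n → ℂ))
    (hρ : Function.Injective ρ) : 2 * f * p ^ f ≤ n := by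
  rw [← hF]
  refine le_of_injective_of_separating hp h2 hF (fun θ hθ => ?_) ρ hρ
  obtain ⟨z, hz⟩ := AddChar.ne_zero_iff.1 hθ
  -- On the line through a point `z` with θ(z) ≠ 1, pairing with ((t - t')⁻¹, 0) recovers `z`
  -- itself.
  refine ⟨fun t => t • z, fun t t' h => ?_⟩
  by_contra hne
  have h0 : t - t' ≠ 0 := sub_ne_zero.2 hne
  apply hz
  rw [← h ((t - t')⁻¹, 0)]
  congr 1
  ext <;> simp [pairing, ← sub_mul, h0]

theorem mul_sq_card_le_of_injective {p f n : ℕ} (hp : p.Prime) (h2 : (2 : F) ≠ 0)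
    (hF : Fintype.card F = p ^ f) (hsq : ¬ IsSquare (-1 : F))
    (ρ : Representation ℂ (LieExp F (F ⊗[ℤ] BinQuadLie)) (Fin n → ℂ))
    (hρ : Function.Injective ρ) : 2 * f * (p ^ f) ^ 2 ≤ n := by
  rw [← hF, sq, ← Fintype.card_prod]
  refine le_of_injective_of_separating hp h2 hF (fun θ hθ => ⟨id, fun y y' h => ?_⟩) ρ hρ
  obtain ⟨z, hz⟩ := AddChar.ne_zero_iff.1 hθ
  simp only [id] at h
  rw [← sub_eq_zero]
  generalize y - y' = w at h ⊢
  by_contra hw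
  -- The norm form of F[i] is anisotropic, so every nonzero `w` is invertible there.
  have hN : w.1 * w.1 + w.2 * w.2 ≠ 0 := by
    intro h0
    by_cases h1 : w.2 = 0
    · apply hw
      ext
      · simpa [h1] using h0
      · exact h1
    · apply hsq
      refine ⟨w.1 / w.2, ?_⟩
      field_simp
      linear_combination -h0
  apply hz
  -- The solution x = z̄w/N(w) of x̄w = z.
  rw [← h ((z.1 * w.1 + z.2 * w.2) / (w.1 * w.1 + w.2 * w.2),
    (z.1 * w.2 - z.2 * w.1) / (w.1 * w.1 + w.2 * w.2))]
  congr 1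
  ext
  · simp only [pairing]
    rw [div_mul_eq_mul_div, div_mul_eq_mul_div, ← add_div, eq_div_iff hN]
    ring
  · simp only [pairing]
    rw [div_mul_eq_mul_div, div_mul_eq_mul_div, ← sub_div, eq_div_iff hN]
    ring

end BinQuadLie

/-! ### The faithful dimension -/

theorem faithfulDim_eq {K G : Type*} [Field K] [Group G] {n : ℕ}
    (h : ∃ ρ : Representation K G (Fin n → K), Function.Injective ρ)
    (hle : ∀ m (ρ : Representation K G (Fin m → K)), Function.Injective ρ → n ≤ m) :
    faithfulDim K G = n :=
  le_antisymm (Nat.sInf_le h) (le_csInf ⟨n, h⟩ fun m ⟨ρ, hρ⟩ => hle m ρ hρ)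

theorem mainTheorem8 (p f : ℕ) (hp : p.Prime) (hp2 : p ≠ 2)
    (F : Type*) [Field F] [Fintype F] (hF : Fintype.card F = p ^ f) :
    (p ≡ 1 [MOD 4] →
      faithfulDim ℂ (LieExp F (F ⊗[ℤ] BinQuadLie)) = 2 * f * p ^ f) ∧
    (p ≡ 3 [MOD 4] → Even f →
      faithfulDim ℂ (LieExp F (F ⊗[ℤ] BinQuadLie)) = 2 * f * p ^ f) ∧
    (p ≡ 3 [MOD 4] → Odd f →
      faithfulDim ℂ (LieExp F (F ⊗[ℤ] BinQuadLie)) = 2 * f * (p ^ f) ^ 2) := by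
  have : Fact p.Prime := ⟨hp⟩
  have : CharP F p := charP_of_card_eq_prime_pow hF
  have h2 : (2 : F) ≠ 0 := Ring.two_ne_zero (by rwa [ringChar.eq F p])
  -- In F, -1 is a square exactly when q is not 3 mod 4; the first two cases both have q ≡ 1.
  have hsquare : p ^ f ≡ 1 [MOD 4] →
      faithfulDim ℂ (LieExp F (F ⊗[ℤ] BinQuadLie)) = 2 * f * p ^ f := by
    intro h
    obtain ⟨i, hi⟩ : IsSquare (-1 : F) := by
      rw [FiniteField.isSquare_neg_one_iff, hF, h]
      decide
    exact faithfulDim_eq (BinQuadLie.exists_faithful_of_sq_eq_neg_one hp h2 hF i hi.symm)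
      fun _ ρ hρ => BinQuadLie.mul_card_le_of_injective hp h2 hF ρ hρ
  refine ⟨fun h => hsquare (by simpa using h.pow f), fun h hf => hsquare ?_, fun h hf => ?_⟩
  · obtain ⟨k, rfl⟩ := hf
    rw [← two_mul, pow_mul]
    have h9 : p ^ 2 ≡ 1 [MOD 4] := h.pow 2
    simpa using h9.pow k
  · have h3 : p ^ f ≡ 3 [MOD 4] := by
      obtain ⟨k, rfl⟩ := hf
      have h9 : p ^ 2 ≡ 1 [MOD 4] := h.pow 2
      rw [pow_succ, pow_mul]
      simpa using (h9.pow k).mul h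
    have hsq : ¬ IsSquare (-1 : F) := by
      rw [FiniteField.isSquare_neg_one_iff, hF, h3]
      decide
    exact faithfulDim_eq (BinQuadLie.exists_faithful hp h2 hF)
      fun _ ρ hρ => BinQuadLie.mul_sq_card_le_of_injective hp h2 hF hsq ρ hρ
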